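/- Let $A$ be a pro-$C^*$-algebra (a complete Hausdorff topological complex $*$-algebra, not necessarily unital, whose topology is determined by the set $S(A)$ of its continuous $C^*$-seminorms). Let $E$ be a Hilbert $A$-module: a right $A$-module and complex vector space, compatibly, with an $A$-valued inner product $\langle\cdot,\cdot\rangle$ that is $\mathbb C$- and $A$-linear in the second variable, satisfies $\langle\xi,\eta\rangle^*=\langle\eta,\xi\rangle$, is positive definite, and makes $E$ complete for the seminorms $\bar p_E(\xi)=p(\langle\xi,\xi\rangle)^{1/2}$, $p\in S(A)$. Let $b(A)=\{a\in A:\|a\|_\infty=\sup_{p\in S(A)}p(a)<\infty\}$, a $C^*$-algebra in the norm $\|\cdot\|_\infty$, and let $b(E)=\{\xi\in E:\sup_{p\in S(A)}\bar p_E(\xi)<\infty\}$, a Hilbert $b(A)$-module with the operations of $E$. A multiplier of $E$ is an element of $M(E)=L(A,E)$, that is, an adjointable module morphism $h:A\to E$, where $A$ is a Hilbert $A$-module with $\langle a,b\rangle=a^*b$. For $h\in M(E)$ and $\xi\in E$ put $\langle h,\xi\rangle_{M(E)}=h^*(\xi)$ and $\langle\xi,h\rangle_{M(E)}=h^*(\xi)^*$.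 A sequence $(h_n)_n$ in $M(E)$ is a standard normalised frame of multipliers in $E$ if for every $\xi\in E$ the series $\sum_n\langle\xi,h_n\rangle_{M(E)}\langle h_n,\xi\rangle_{M(E)}$ converges in $A$ and $$\langle\xi,\xi\rangle\le\sum_n\langle\xi,h_n\rangle_{M(E)}\langle h_n,\xi\rangle_{M(E)}\le\langle\xi,\xi\rangle .$$ The same definitions apply to the Hilbert $b(A)$-module $b(E)$, where the convergence is in the norm of $b(A)$. If $b(E)$ admits a standard normalised frame of multipliers, then so does $E$. More precisely, let $(h_n)_n$ be a standard normalised frame of multipliers in $b(E)$. Then for every $n$ there is exactly one $\widetilde h_n\in M(E)$ with $\widetilde h_n(a)=h_n(a)$ for all $a\in b(A)$, and $(\widetilde h_n)_n$ is a standard normalised frame of multipliers in $E$. -/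

import Mathlib

open Filter Topology
open scoped RightActions

universe u v w

/-! ### Pro-C⋆-algebras -/

/-- A `C⋆`-seminorm on a complex `⋆`-algebra: a seminorm `p` with `p (a b) ≤ p a * p b` and
`p (a⋆ a) = p a ^ 2`. -/
structure CStarSeminorm (A : Type u) [NonUnitalRing A] [StarRing A] [Module ℂ A]
    extends Seminorm ℂ A where
  mul_le' : ∀ a b, toFun (a * b) ≤ toFun a * toFun b
  star_mul_self' : ∀ a, toFun (star a * a) = toFun a ^ 2

noncomputable instance CStarSeminorm.instCoeFun {A : Type u} [NonUnitalRing A] [StarRing A]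
    [Module ℂ A] : CoeFun (CStarSeminorm A) (fun _ => A → ℝ) := ⟨fun p => p.toSeminorm⟩

/-- `S(A)`: the set of all continuous `C⋆`-seminorms on `A`. -/
abbrev ContCStarSeminorm (A : Type u) [NonUnitalRing A] [StarRing A] [Module ℂ A]
    [TopologicalSpace A] : Type u :=
  {p : CStarSeminorm A // Continuous (p : A → ℝ)}

/-- A (not necessarily unital) pro-`C⋆`-algebra: a complete Hausdorff topological complex
`⋆`-algebra whose topology is determined by its continuous `C⋆`-seminorms. -/
class ProCStarAlgebra (A : Type u) extends NonUnitalRing A, StarRing A, Module ℂ A,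
    IsScalarTower ℂ A A, SMulCommClass ℂ A A, StarModule ℂ A, UniformSpace A,
    IsUniformAddGroup A, CompleteSpace A, T2Space A where
  withSeminorms : WithSeminorms (fun p : ContCStarSeminorm A => p.1.toSeminorm)

namespace CStarSeminorm

section basic
variable {A : Type u} [ProCStarAlgebra A] (p : CStarSeminorm A)

theorem mul_le (a b : A) : p (a * b) ≤ p a * p b := p.mul_le' a b

theorem star_mul_self (a : A) : p (star a * a) = p a ^ 2 := p.star_mul_self' a

theorem nonneg (a : A) : 0 ≤ p a := apply_nonneg p.toSeminorm a

theorem map_star (a : A) : p (star a) = p a := by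
  have key : ∀ b : A, p b ≤ p (star b) := fun b => by
    have h1 := p.star_mul_self b
    have h2 := p.mul_le (star b) b
    rcases (p.nonneg b).eq_or_lt with h | h
    · rw [← h]; exact p.nonneg _
    · nlinarith
  exact le_antisymm (by simpa using key (star a)) (key a)

end basic

/-! #### Every `C⋆`-seminorm is the norm of a `⋆`-representation in a `C⋆`-algebra -/

section completion
open UniformSpace

theorem completion_smul_mul {U : Type u} [NormedRing U] [NormedAlgebra ℂ U] (c : ℂ)
    (x y : Completion U) : (c • x) * y = c • (x * y) := by
  induction x, y using Completion.induction_on₂ with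
  | hp => exact isClosed_eq ((continuous_fst.const_smul c).mul continuous_snd)
            ((continuous_fst.mul continuous_snd).const_smul c)
  | ih a b => rw [← Completion.coe_smul, ← Completion.coe_mul, ← Completion.coe_mul,
              ← Completion.coe_smul, smul_mul_assoc]

theorem completion_mul_smul {U : Type u} [NormedRing U] [NormedAlgebra ℂ U] (c : ℂ)
    (x y : Completion U) : x * (c • y) = c • (x * y) := by
  induction x, y using Completion.induction_on₂ with
  | hp => exact isClosed_eq (continuous_fst.mul (continuous_snd.const_smul c))
            ((continuous_fst.mul continuous_snd).const_smul c)
  | ih a b => rw [← Completion.coe_smul, ← Completion.coe_mul, ← Completion.coe_mul,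
              ← Completion.coe_smul, mul_smul_comm]

/-- The completion of a unital algebra with a `C⋆`-norm is a `C⋆`-algebra. -/
@[reducible]
noncomputable def completionCStarAlgebra (U : Type u) [NormedRing U] [StarRing U] [CStarRing U]
    [NormedAlgebra ℂ U] [StarModule ℂ U] : CStarAlgebra (Completion U) :=
  have hu : UniformContinuous (star : U → U) := star_isometry.uniformContinuous
  letI : Star (Completion U) := ⟨Completion.map star⟩
  have hc : Continuous (star : Completion U → Completion U) := Completion.continuous_map
  have hcoe (a : U) : star (a : Completion U) = ((star a : U) : Completion U) :=
    Completion.map_coe hu a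
  letI : NormedAlgebra ℂ (Completion U) :=
    { Algebra.ofModule (R := ℂ) (A := Completion U) completion_smul_mul completion_mul_smul with
      norm_smul_le := norm_smul_le }
  { (inferInstance : NormedRing (Completion U)),
    (inferInstance : NormedAlgebra ℂ (Completion U)),
    (inferInstance : CompleteSpace (Completion U)) with
    star := star
    star_involutive := fun x => Completion.induction_on x
      (isClosed_eq (hc.comp hc) continuous_id) (fun a => by simp [hcoe])
    star_mul := fun x y => Completion.induction_on₂ x y
      (isClosed_eq (hc.comp (continuous_fst.mul continuous_snd))
          ((hc.comp continuous_snd).mul (hc.comp continuous_fst)))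
      (fun a b => by simp [hcoe, ← Completion.coe_mul])
    star_add := fun x y => Completion.induction_on₂ x y
      (isClosed_eq (hc.comp (continuous_fst.add continuous_snd))
          ((hc.comp continuous_fst).add (hc.comp continuous_snd)))
      (fun a b => by simp [hcoe, ← Completion.coe_add])
    norm_mul_self_le := fun x => Completion.induction_on x
      (isClosed_le (continuous_norm.mul continuous_norm)
          (continuous_norm.comp (hc.mul continuous_id)))
      (fun a => by simp [hcoe, ← Completion.coe_mul, CStarRing.norm_star_mul_self])
    star_smul := fun c x => Completion.induction_on x
      (isClosed_eq (hc.comp (continuous_const_smul c))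
          ((continuous_const_smul (star c)).comp hc))
      (fun a => by
        change star (c • (a : Completion U)) = star c • star (a : Completion U)
        rw [hcoe, ← Completion.coe_smul, ← Completion.coe_smul, hcoe, star_smul]) }

theorem exists_cstar_completion_unital (U : Type u) [NormedRing U] [StarRing U] [CStarRing U]
    [NormedAlgebra ℂ U] [StarModule ℂ U] :
    ∃ (B : Type u) (_ : CStarAlgebra B) (φ : U →⋆ₙₐ[ℂ] B), ∀ a, ‖φ a‖ = ‖a‖ := by
  let _ := completionCStarAlgebra U
  exact ⟨Completion U, inferInstance,
    { toFun := fun a => (a : Completion U)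
      map_smul' := fun c a => Completion.coe_smul c a
      map_zero' := Completion.coe_zero
      map_add' := fun a b => Completion.coe_add a b
      map_mul' := fun a b => Completion.coe_mul a b
      map_star' := fun a =>
        (Completion.map_coe (star_isometry (E := U)).uniformContinuous a).symm },
    fun a => Completion.norm_coe a⟩

theorem exists_cstar_completion (Q : Type u) [NonUnitalNormedRing Q] [StarRing Q] [CStarRing Q]
    [NormedSpace ℂ Q] [IsScalarTower ℂ Q Q] [SMulCommClass ℂ Q Q] [StarModule ℂ Q] :
    ∃ (B : Type u) (_ : CStarAlgebra B) (φ : Q →⋆ₙₐ[ℂ] B), ∀ a, ‖φ a‖ = ‖a‖ := by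
  obtain ⟨B, hB, φ, hφ⟩ := exists_cstar_completion_unital (Unitization ℂ Q)
  exact ⟨B, hB, φ.comp (Unitization.inrNonUnitalStarAlgHom ℂ Q),
    fun a => (hφ _).trans (Unitization.norm_inr a)⟩

end completion

section quotient
variable {A : Type u} [ProCStarAlgebra A] (p : CStarSeminorm A)

/-- `A` regarded as a seminormed algebra through `p`. -/
def Pre (_ : CStarSeminorm A) : Type u := A

instance : NonUnitalRing p.Pre := inferInstanceAs (NonUnitalRing A)
instance : StarRing p.Pre := inferInstanceAs (StarRing A)
instance : Module ℂ p.Pre := inferInstanceAs (Module ℂ A)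
instance : IsScalarTower ℂ p.Pre p.Pre := inferInstanceAs (IsScalarTower ℂ A A)
instance : SMulCommClass ℂ p.Pre p.Pre := inferInstanceAs (SMulCommClass ℂ A A)
instance : StarModule ℂ p.Pre := inferInstanceAs (StarModule ℂ A)

noncomputable instance : SeminormedAddCommGroup p.Pre :=
  AddGroupSeminorm.toSeminormedAddCommGroup (E := p.Pre) p.toSeminorm.toAddGroupSeminorm

noncomputable instance : NonUnitalSeminormedRing p.Pre :=
  { (inferInstance : NonUnitalRing p.Pre),
    (inferInstance : SeminormedAddCommGroup p.Pre) with
    norm_mul_le := p.mul_le }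

noncomputable instance : NormedSpace ℂ p.Pre where
  norm_smul_le c a := (map_smul_eq_mul p.toSeminorm c a).le

theorem norm_pre (a : p.Pre) : ‖a‖ = p a := rfl

instance : NormedStarGroup p.Pre := ⟨fun a => (p.map_star a).le⟩

/-- The quotient `A / ker p` with the norm induced by `p`. -/
abbrev Quo : Type u := SeparationQuotient p.Pre

theorem inseparable_star {a b : p.Pre} (h : Inseparable a b) :
    Inseparable (star a) (star b) := h.map continuous_star

noncomputable instance : StarRing p.Quo where
  star := SeparationQuotient.lift (fun a => SeparationQuotient.mk (star a))
    (fun _ _ h => SeparationQuotient.mk_eq_mk.2 (p.inseparable_star h))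
  star_involutive x := by
    obtain ⟨a, rfl⟩ := SeparationQuotient.surjective_mk x
    exact congrArg SeparationQuotient.mk (star_star a)
  star_mul x y := by
    obtain ⟨a, rfl⟩ := SeparationQuotient.surjective_mk x
    obtain ⟨b, rfl⟩ := SeparationQuotient.surjective_mk y
    exact congrArg SeparationQuotient.mk (star_mul a b)
  star_add x y := by
    obtain ⟨a, rfl⟩ := SeparationQuotient.surjective_mk x
    obtain ⟨b, rfl⟩ := SeparationQuotient.surjective_mk y
    exact congrArg SeparationQuotient.mk (star_add a b)

theorem mk_star (a : p.Pre) :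
    star (SeparationQuotient.mk a : p.Quo) = SeparationQuotient.mk (star a) := rfl

instance : IsScalarTower ℂ p.Quo p.Quo where
  smul_assoc c x y := by
    obtain ⟨a, rfl⟩ := SeparationQuotient.surjective_mk x
    obtain ⟨b, rfl⟩ := SeparationQuotient.surjective_mk y
    exact congrArg SeparationQuotient.mk (smul_mul_assoc c a b)

instance : SMulCommClass ℂ p.Quo p.Quo where
  smul_comm c x y := by
    obtain ⟨a, rfl⟩ := SeparationQuotient.surjective_mk x
    obtain ⟨b, rfl⟩ := SeparationQuotient.surjective_mk y
    exact congrArg SeparationQuotient.mk (mul_smul_comm c a b).symm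

instance : StarModule ℂ p.Quo where
  star_smul c x := by
    obtain ⟨a, rfl⟩ := SeparationQuotient.surjective_mk x
    exact congrArg SeparationQuotient.mk (star_smul c a)

instance : CStarRing p.Quo where
  norm_mul_self_le x := by
    obtain ⟨a, rfl⟩ := SeparationQuotient.surjective_mk x
    rw [p.mk_star, ← SeparationQuotient.mk_mul, SeparationQuotient.norm_mk,
      SeparationQuotient.norm_mk]
    exact ((p.star_mul_self a).trans (sq _)).ge

theorem exists_cstar_rep :
    ∃ (B : Type u) (_ : CStarAlgebra B) (φ : A →⋆ₙₐ[ℂ] B), ∀ a, ‖φ a‖ = p a := by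
  obtain ⟨B, hB, φ, hφ⟩ := exists_cstar_completion p.Quo
  refine ⟨B, hB, φ.comp
    { toFun := fun a => (SeparationQuotient.mk (show p.Pre from a) : p.Quo)
      map_smul' := fun _ _ => rfl
      map_zero' := rfl
      map_add' := fun _ _ => rfl
      map_mul' := fun _ _ => rfl
      map_star' := fun _ => rfl }, fun a => ?_⟩
  exact (hφ _).trans (SeparationQuotient.norm_mk (show p.Pre from a))

end quotient
end CStarSeminorm

/-- Positivity in a pro-`C⋆`-algebra: `a ≥ 0` means that `a = b⋆ b` for some `b`. -/
def IsPositive {A : Type u} [ProCStarAlgebra A] (a : A) : Prop := ∃ b : A, a = star b * b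

/-- The order of a pro-`C⋆`-algebra: `a ≤ b` means that `b - a` is positive. -/
def PosLE {A : Type u} [ProCStarAlgebra A] (a b : A) : Prop := IsPositive (b - a)

/-! ### Hilbert modules -/

/-- A pre-Hilbert (right) `A`-module. The right action of `a` on `ξ` is written `ξ <• a`. -/
class PreHilbertModule (A : Type u) (E : Type v) [ProCStarAlgebra A] [AddCommGroup E]
    [Module ℂ E] extends SMul Aᵐᵒᵖ E, Inner A E where
  act_add : ∀ (ξ : E) (a b : A), ξ <• (a + b) = ξ <• a + ξ <• b
  add_act : ∀ (ξ η : E) (a : A), (ξ + η) <• a = ξ <• a + η <• a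
  act_mul : ∀ (ξ : E) (a b : A), ξ <• (a * b) = (ξ <• a) <• b
  act_smul : ∀ (c : ℂ) (ξ : E) (a : A), ξ <• (c • a) = c • (ξ <• a)
  smul_act : ∀ (c : ℂ) (ξ : E) (a : A), (c • ξ) <• a = c • (ξ <• a)
  inner_add_right : ∀ ξ η ζ : E, inner ξ (η + ζ) = inner ξ η + inner ξ ζ
  inner_smul_right : ∀ (c : ℂ) (ξ η : E), inner ξ (c • η) = c • inner ξ η
  inner_act_right : ∀ (ξ η : E) (a : A), inner ξ (η <• a) = inner ξ η * a
  star_inner : ∀ ξ η : E, star (inner ξ η) = inner η ξ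
  inner_self_nonneg : ∀ ξ : E, IsPositive (inner ξ ξ)
  inner_self_eq_zero : ∀ ξ : E, inner ξ ξ = 0 ↔ ξ = 0

/-- The seminorm `p̄_E(ξ) = √(p ⟨ξ, ξ⟩)` on a pre-Hilbert `A`-module. -/
noncomputable def CStarSeminorm.bar {A : Type u} [ProCStarAlgebra A] (p : CStarSeminorm A)
    {E : Type v} [AddCommGroup E] [Module ℂ E] [PreHilbertModule A E] (ξ : E) : ℝ :=
  √(p (inner A ξ ξ))

/-- A Hilbert `A`-module: a pre-Hilbert `A`-module which is complete for the family of seminorms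
`p̄_E`, `p ∈ S(A)`; that is, every Cauchy filter for these seminorms converges for them. -/
class HilbertModule (A : Type u) (E : Type v) [ProCStarAlgebra A] [AddCommGroup E]
    [Module ℂ E] extends PreHilbertModule A E where
  complete : ∀ F : Filter E, F.NeBot →
    (∀ p : ContCStarSeminorm A, Tendsto (fun x : E × E => p.1.bar (x.1 - x.2)) (F ×ˢ F) (𝓝 0)) →
    ∃ ξ : E, ∀ p : ContCStarSeminorm A, Tendsto (fun η : E => p.1.bar (η - ξ)) F (𝓝 0)

namespace PreHilbertModule

variable {A : Type u} [ProCStarAlgebra A] {E : Type v} [AddCommGroup E] [Module ℂ E]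
  [PreHilbertModule A E]

theorem inner_add_left (ξ η ζ : E) : inner A (ξ + η) ζ = inner A ξ ζ + inner A η ζ := by
  rw [← star_inner, inner_add_right, star_add, star_inner, star_inner]

theorem inner_smul_left (c : ℂ) (ξ η : E) : inner A (c • ξ) η = star c • inner A ξ η := by
  rw [← star_inner, inner_smul_right, star_smul, star_inner]

theorem inner_act_left (ξ η : E) (a : A) : inner A (ξ <• a) η = star a * inner A ξ η := by
  rw [← star_inner, inner_act_right, star_mul, star_inner]

variable (p : CStarSeminorm A)

theorem bar_nonneg (ξ : E) : 0 ≤ p.bar ξ := Real.sqrt_nonneg _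

theorem bar_sq (ξ : E) : p.bar ξ ^ 2 = p (inner A ξ ξ) := Real.sq_sqrt (p.nonneg _)

theorem bar_smul (c : ℂ) (ξ : E) : p.bar (c • ξ) = ‖c‖ * p.bar ξ := by
  have h : p.bar (c • ξ) ^ 2 = (‖c‖ * p.bar ξ) ^ 2 := by
    rw [bar_sq, mul_pow, bar_sq, inner_smul_right, inner_smul_left, smul_smul,
      map_smul_eq_mul, norm_mul, norm_star, sq]
  exact (pow_left_inj₀ (bar_nonneg p _) (mul_nonneg (norm_nonneg c) (bar_nonneg p ξ))
    two_ne_zero).1 h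

/-- The Cauchy–Schwarz inequality `p ⟨ξ, η⟩ ≤ p̄_E(ξ) p̄_E(η)`. -/
theorem inner_le_bar (ξ η : E) : p (inner A ξ η) ≤ p.bar ξ * p.bar η := by
  obtain ⟨B, hB, φ, hφ⟩ := p.exists_cstar_rep
  let _ : PartialOrder B := CStarAlgebra.spectralOrder B
  have : StarOrderedRing B := CStarAlgebra.spectralOrderedRing B
  set a : A := inner A ξ η with ha
  set K := p (inner A ξ ξ) with hK
  have hK0 : 0 ≤ K := p.nonneg _
  have pos : ∀ ζ : E, 0 ≤ φ (inner A ζ ζ) := fun ζ => by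
    obtain ⟨b, hb⟩ := inner_self_nonneg (A := A) ζ
    rw [hb, map_mul, map_star φ]
    exact star_mul_self_nonneg _
  have main : ∀ t : ℝ, 0 ≤ t → 0 ≤ 2 * t - t ^ 2 * K →
      (2 * t - t ^ 2 * K) * p a ^ 2 ≤ p (inner A η η) := by
    intro t ht hc
    have e1 : inner A ((t : ℂ) • (ξ <• a) + (-1 : ℂ) • η) ((t : ℂ) • (ξ <• a) + (-1 : ℂ) • η)
        = ((t ^ 2 : ℝ) : ℂ) • (star a * inner A ξ ξ * a) - ((2 * t : ℝ) : ℂ) • (star a * a)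
          + inner A η η := by
      have h2 : inner A η ξ = star a := by rw [ha, star_inner]
      simp only [inner_add_right, inner_add_left, inner_smul_left, inner_smul_right,
        inner_act_left, inner_act_right, h2, ← ha]
      push_cast
      simp only [star_neg, star_one, RCLike.star_def, Complex.conj_ofReal]
      simp only [add_mul, smul_mul_assoc]
      module
    have h0 := pos ((t : ℂ) • (ξ <• a) + (-1 : ℂ) • η)
    rw [e1, map_add, map_sub, map_smul, map_smul, map_mul, map_mul, map_mul, map_star φ] at h0
    have h1 : star (φ a) * φ (inner A ξ ξ) * φ a ≤ K • (star (φ a) * φ a) := by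
      have hle : φ (inner A ξ ξ) ≤ algebraMap ℝ B K := by
        rw [hK, ← hφ]
        exact IsSelfAdjoint.le_algebraMap_norm_self (IsSelfAdjoint.of_nonneg (pos ξ))
      have := star_left_conjugate_le_conjugate hle (φ a)
      rwa [Algebra.algebraMap_eq_smul_one, mul_smul_comm, mul_one, smul_mul_assoc] at this
    have hrs : ∀ (r : ℝ) (b : B), (r : ℂ) • b = r • b := fun r b => by simp
    rw [hrs, hrs] at h0
    have h2 : (2 * t - t ^ 2 * K) • (star (φ a) * φ a) ≤ φ (inner A η η) := by
      have h3 : (t ^ 2) • (star (φ a) * φ (inner A ξ ξ) * φ a)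
          ≤ (t ^ 2) • (K • (star (φ a) * φ a)) := smul_le_smul_of_nonneg_left h1 (sq_nonneg t)
      rw [← sub_nonneg] at h3 ⊢
      have := add_nonneg h0 h3
      convert this using 1
      module
    have h4 := CStarAlgebra.norm_le_norm_of_nonneg_of_le
      (smul_nonneg hc (star_mul_self_nonneg (φ a))) h2
    rw [norm_smul, Real.norm_of_nonneg hc, CStarRing.norm_star_mul_self, hφ, hφ] at h4
    rwa [← sq (p a)] at h4
  have key : p a ^ 2 ≤ K * p (inner A η η) := by
    rcases hK0.eq_or_lt with h | h
    · rw [← h] at main ⊢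
      by_contra hne
      have hpos : 0 < p a ^ 2 := by
        rw [zero_mul] at hne
        exact not_le.1 hne
      have h5 := main ((p (inner A η η) + 1) / p a ^ 2)
        (div_nonneg (add_nonneg (p.nonneg _) zero_le_one) hpos.le)
        (by
          have := div_nonneg (add_nonneg (p.nonneg (inner A η η)) zero_le_one) hpos.le
          simpa using this)
      have h6 := p.nonneg (inner A η η)
      have h7 : (p (inner A η η) + 1) / p a ^ 2 * p a ^ 2 = p (inner A η η) + 1 :=
        div_mul_cancel₀ _ hpos.ne'
      nlinarith
    · have h5 := main K⁻¹ (inv_nonneg.2 hK0) (by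
        have : 2 * K⁻¹ - K⁻¹ ^ 2 * K = K⁻¹ := by field_simp; ring
        rw [this]; exact inv_nonneg.2 hK0)
      have h6 : 2 * K⁻¹ - K⁻¹ ^ 2 * K = K⁻¹ := by field_simp; ring
      rw [h6, inv_mul_le_iff₀ h] at h5
      exact h5
  refine abs_le_of_sq_le_sq' (?_ : p a ^ 2 ≤ (p.bar ξ * p.bar η) ^ 2)
    (mul_nonneg (bar_nonneg p ξ) (bar_nonneg p η)) |>.2
  rw [mul_pow, bar_sq, bar_sq]
  exact key

theorem bar_add_le (ξ η : E) : p.bar (ξ + η) ≤ p.bar ξ + p.bar η := by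
  refine abs_le_of_sq_le_sq' (?_ : p.bar (ξ + η) ^ 2 ≤ (p.bar ξ + p.bar η) ^ 2)
    (add_nonneg (bar_nonneg p ξ) (bar_nonneg p η)) |>.2
  rw [bar_sq, inner_add_right, inner_add_left, inner_add_left]
  have h1 := inner_le_bar p ξ η
  have h2 := inner_le_bar p η ξ
  have h3 := bar_sq p ξ
  have h4 := bar_sq p η
  have h5 := map_add_le_add p.toSeminorm (inner A ξ ξ + inner A η ξ) (inner A ξ η + inner A η η)
  have h6 := map_add_le_add p.toSeminorm (inner A ξ ξ) (inner A η ξ)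
  have h7 := map_add_le_add p.toSeminorm (inner A ξ η) (inner A η η)
  nlinarith

theorem bar_act_le (ξ : E) (a : A) : p.bar (ξ <• a) ≤ p.bar ξ * p a := by
  refine abs_le_of_sq_le_sq' (?_ : p.bar (ξ <• a) ^ 2 ≤ (p.bar ξ * p a) ^ 2)
    (mul_nonneg (bar_nonneg p ξ) (p.nonneg a)) |>.2
  rw [bar_sq, inner_act_right, inner_act_left, mul_pow, bar_sq]
  have h1 := p.mul_le (star a * inner A ξ ξ) a
  have h2 := p.mul_le (star a) (inner A ξ ξ)
  rw [p.map_star] at h2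
  have h3 := p.nonneg a
  nlinarith

end PreHilbertModule

namespace ProCStarAlgebra

variable {A : Type u} [ProCStarAlgebra A]

theorem eq_zero_of_forall {a : A} (h : ∀ p : ContCStarSeminorm A, p.1 a = 0) : a = 0 := by
  by_contra hne
  obtain ⟨p, hp⟩ := (withSeminorms (A := A)).separating_of_T1 a hne
  exact hp (h p)

theorem star_mul_self_eq_zero {a : A} : star a * a = 0 ↔ a = 0 := by
  refine ⟨fun h => eq_zero_of_forall fun p => ?_, fun h => by simp [h]⟩
  have := p.1.star_mul_self a
  rw [h, map_zero] at this
  exact pow_eq_zero_iff two_ne_zero |>.1 this.symm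

theorem tendsto_iff {ι : Type w} {F : Filter ι} {u : ι → A} {a : A} :
    Tendsto u F (𝓝 a) ↔ ∀ p : ContCStarSeminorm A, Tendsto (fun i => p.1 (u i - a)) F (𝓝 0) := by
  rw [(withSeminorms (A := A)).tendsto_nhds]
  refine forall_congr' fun p => ?_
  rw [Metric.tendsto_nhds]
  refine forall₂_congr fun ε _ => ?_
  simp only [Real.dist_eq, sub_zero, abs_of_nonneg (p.1.nonneg _)]

theorem cauchy_of_tendsto {F : Filter A} (hF : F.NeBot)
    (h : ∀ p : ContCStarSeminorm A, Tendsto (fun x : A × A => p.1 (x.1 - x.2)) (F ×ˢ F) (𝓝 0)) :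
    Cauchy F := by
  refine ⟨hF, ?_⟩
  rw [uniformity_eq_comap_nhds_zero, ← tendsto_iff_comap, tendsto_iff]
  intro p
  simpa only [sub_zero, map_sub_rev] using h p

end ProCStarAlgebra

/-- A pro-`C⋆`-algebra `A` is a Hilbert `A`-module with `⟨a, b⟩ = a⋆ b`. -/
noncomputable instance ProCStarAlgebra.instHilbertModule {A : Type u} [ProCStarAlgebra A] :
    HilbertModule A A where
  inner a b := star a * b
  act_add ξ a b := mul_add ξ a b
  add_act ξ η a := add_mul ξ η a
  act_mul ξ a b := (mul_assoc ξ a b).symm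
  act_smul c ξ a := mul_smul_comm c ξ a
  smul_act c ξ a := smul_mul_assoc c ξ a
  inner_add_right ξ η ζ := mul_add _ _ _
  inner_smul_right c ξ η := mul_smul_comm _ _ _
  inner_act_right ξ η a := (mul_assoc _ _ _).symm
  star_inner ξ η := by rw [star_mul, star_star]
  inner_self_nonneg ξ := ⟨ξ, rfl⟩
  inner_self_eq_zero ξ := ProCStarAlgebra.star_mul_self_eq_zero
  complete F hF hc := by
    have hbar : ∀ (p : CStarSeminorm A) (a : A), √(p (star a * a)) = p a := fun p a => by
      rw [p.star_mul_self, Real.sqrt_sq (p.nonneg a)]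
    change ∀ p : ContCStarSeminorm A, Tendsto
      (fun x : A × A => √(p.1 (star (x.1 - x.2) * (x.1 - x.2)))) (F ×ˢ F) (𝓝 0) at hc
    simp only [hbar] at hc
    obtain ⟨a, ha⟩ := CompleteSpace.complete (ProCStarAlgebra.cauchy_of_tendsto hF hc)
    refine ⟨a, fun p => ?_⟩
    change Tendsto (fun x : A => √(p.1 (star (x - a) * (x - a)))) F (𝓝 0)
    simp only [hbar]
    exact ProCStarAlgebra.tendsto_iff.1 (tendsto_id'.2 ha) p

/-! ### Bounded parts -/

section boundedAlgebra

variable (A : Type u) [ProCStarAlgebra A]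

instance : Nonempty (ContCStarSeminorm A) :=
  ⟨⟨{ (0 : Seminorm ℂ A) with
      mul_le' := fun _ _ => (mul_zero (0 : ℝ)).ge
      star_mul_self' := fun _ => (zero_pow two_ne_zero : (0 : ℝ) ^ 2 = 0).symm }, continuous_const⟩⟩

/-- The `⋆`-subalgebra of all `a` with `sup {p a | p ∈ S(A)} < ∞`. -/
def boundedSubalgebra : NonUnitalStarSubalgebra ℂ A where
  carrier := {a | BddAbove (Set.range fun p : ContCStarSeminorm A => p.1 a)}
  zero_mem' := ⟨0, by rintro _ ⟨p, rfl⟩; simp⟩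
  add_mem' := by
    rintro a b ⟨M, hM⟩ ⟨N, hN⟩
    refine ⟨M + N, ?_⟩
    rintro _ ⟨p, rfl⟩
    exact (map_add_le_add p.1.toSeminorm a b).trans (add_le_add (hM ⟨p, rfl⟩) (hN ⟨p, rfl⟩))
  mul_mem' := by
    rintro a b ⟨M, hM⟩ ⟨N, hN⟩
    refine ⟨M * N, ?_⟩
    rintro _ ⟨p, rfl⟩
    exact (p.1.mul_le a b).trans (mul_le_mul (hM ⟨p, rfl⟩) (hN ⟨p, rfl⟩) (p.1.nonneg _)
      ((p.1.nonneg _).trans (hM ⟨p, rfl⟩)))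
  smul_mem' := by
    rintro c a ⟨M, hM⟩
    refine ⟨‖c‖ * M, ?_⟩
    rintro _ ⟨p, rfl⟩
    exact (map_smul_eq_mul p.1.toSeminorm c a).le.trans
      (mul_le_mul_of_nonneg_left (hM ⟨p, rfl⟩) (norm_nonneg c))
  star_mem' := by
    rintro a ⟨M, hM⟩
    refine ⟨M, ?_⟩
    rintro _ ⟨p, rfl⟩
    exact (p.1.map_star a).le.trans (hM ⟨p, rfl⟩)

/-- `b(A)`: the algebra of bounded elements of `A`. It carries the norm `‖·‖_∞` and the norm
topology, not the topology induced from `A`. -/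
def BoundedAlgebra : Type u := boundedSubalgebra A

namespace BoundedAlgebra

noncomputable instance : NonUnitalRing (BoundedAlgebra A) :=
  inferInstanceAs (NonUnitalRing (boundedSubalgebra A))
noncomputable instance : StarRing (BoundedAlgebra A) :=
  inferInstanceAs (StarRing (boundedSubalgebra A))
noncomputable instance : Module ℂ (BoundedAlgebra A) :=
  inferInstanceAs (Module ℂ (boundedSubalgebra A))
instance : IsScalarTower ℂ (BoundedAlgebra A) (BoundedAlgebra A) :=
  inferInstanceAs (IsScalarTower ℂ (boundedSubalgebra A) (boundedSubalgebra A))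
instance : SMulCommClass ℂ (BoundedAlgebra A) (BoundedAlgebra A) :=
  inferInstanceAs (SMulCommClass ℂ (boundedSubalgebra A) (boundedSubalgebra A))
instance : StarModule ℂ (BoundedAlgebra A) :=
  inferInstanceAs (StarModule ℂ (boundedSubalgebra A))

variable {A}

/-- The inclusion `b(A) ⊆ A`. -/
def val : BoundedAlgebra A →⋆ₙₐ[ℂ] A := NonUnitalStarSubalgebraClass.subtype (boundedSubalgebra A)

theorem val_injective : Function.Injective (val : BoundedAlgebra A → A) := Subtype.val_injective

/-- A bounded element of `A`, as an element of `b(A)`. -/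
def mk (a : A) (h : BddAbove (Set.range fun p : ContCStarSeminorm A => p.1 a)) :
    BoundedAlgebra A := ⟨a, h⟩

@[simp] theorem val_mk (a : A) (h : BddAbove (Set.range fun p : ContCStarSeminorm A => p.1 a)) :
    val (mk a h) = a := rfl

theorem bddAbove (a : BoundedAlgebra A) :
    BddAbove (Set.range fun p : ContCStarSeminorm A => p.1 (val a)) := a.2

/-- The norm `‖a‖_∞ = sup {p a | p ∈ S(A)}`. -/
noncomputable instance : Norm (BoundedAlgebra A) where
  norm a := ⨆ p : ContCStarSeminorm A, p.1 (val a)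

theorem norm_def (a : BoundedAlgebra A) : ‖a‖ = ⨆ p : ContCStarSeminorm A, p.1 (val a) := rfl

theorem le_norm (p : ContCStarSeminorm A) (a : BoundedAlgebra A) : p.1 (val a) ≤ ‖a‖ :=
  le_ciSup a.bddAbove p

theorem norm_le {a : BoundedAlgebra A} {M : ℝ} (h : ∀ p : ContCStarSeminorm A, p.1 (val a) ≤ M) :
    ‖a‖ ≤ M := ciSup_le h

theorem norm_nonneg' (a : BoundedAlgebra A) : 0 ≤ ‖a‖ :=
  Real.iSup_nonneg fun p => p.1.nonneg _

theorem norm_smul_le' (c : ℂ) (a : BoundedAlgebra A) : ‖c • a‖ ≤ ‖c‖ * ‖a‖ :=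
  norm_le fun p => by
    rw [map_smul, map_smul_eq_mul]
    exact mul_le_mul_of_nonneg_left (le_norm p a) (norm_nonneg c)

noncomputable instance : NormedAddCommGroup (BoundedAlgebra A) :=
  AddGroupNorm.toNormedAddCommGroup
    { toFun := fun a => ‖a‖
      map_zero' := le_antisymm (norm_le fun p => by simp) (norm_nonneg' _)
      add_le' := fun a b => norm_le fun p => by
        rw [map_add]
        exact (map_add_le_add p.1.toSeminorm _ _).trans (add_le_add (le_norm p a) (le_norm p b))
      neg' := fun a => by simp only [norm_def, map_neg, map_neg_eq_map]
      eq_zero_of_map_eq_zero' := fun a h => val_injective <| by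
        rw [map_zero]
        exact ProCStarAlgebra.eq_zero_of_forall fun p =>
          le_antisymm ((le_norm p a).trans h.le) (p.1.nonneg _) }

noncomputable instance : NonUnitalNormedRing (BoundedAlgebra A) :=
  { (inferInstance : NonUnitalRing (BoundedAlgebra A)),
    (inferInstance : NormedAddCommGroup (BoundedAlgebra A)) with
    norm_mul_le := fun a b => norm_le fun p => by
      rw [map_mul]
      exact (p.1.mul_le _ _).trans (mul_le_mul (le_norm p a) (le_norm p b) (p.1.nonneg _)
        (norm_nonneg' a)) }

noncomputable instance : NormedSpace ℂ (BoundedAlgebra A) where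
  norm_smul_le := norm_smul_le'

instance : CStarRing (BoundedAlgebra A) where
  norm_mul_self_le a := by
    have h0 := norm_nonneg (star a * a)
    have : ‖a‖ ≤ √‖star a * a‖ := norm_le fun p => by
      refine Real.le_sqrt_of_sq_le ?_
      rw [← p.1.star_mul_self, ← map_star val, ← map_mul]
      exact le_norm p _
    calc ‖a‖ * ‖a‖ ≤ √‖star a * a‖ * √‖star a * a‖ :=
          mul_self_le_mul_self (norm_nonneg a) this
      _ = ‖star a * a‖ := Real.mul_self_sqrt h0

instance : CompleteSpace (BoundedAlgebra A) := by
  refine Metric.complete_of_cauchySeq_tendsto fun u hu => ?_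
  rw [Metric.cauchySeq_iff] at hu
  have hle : ∀ (p : ContCStarSeminorm A) (m n : ℕ), p.1 (val (u m) - val (u n)) ≤
      dist (u m) (u n) := fun p m n => by
    rw [dist_eq_norm, ← map_sub]; exact le_norm p _
  have hc : Cauchy (map (fun n => val (u n)) atTop) := by
    refine ProCStarAlgebra.cauchy_of_tendsto inferInstance fun p => ?_
    rw [Filter.prod_map_map_eq, Filter.tendsto_map'_iff, Metric.tendsto_nhds]
    intro ε hε
    obtain ⟨N, hN⟩ := hu ε hε
    filter_upwards [prod_mem_prod (Ici_mem_atTop N) (Ici_mem_atTop N)] with x hx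
    simp only [Function.comp, Real.dist_eq, sub_zero, abs_of_nonneg (p.1.nonneg _)]
    exact (hle p _ _).trans_lt (hN _ hx.1 _ hx.2)
  obtain ⟨a, ha⟩ := CompleteSpace.complete hc
  have ha' : Tendsto (fun n => val (u n)) atTop (𝓝 a) := ha
  rw [ProCStarAlgebra.tendsto_iff] at ha'
  have key : ∀ ε > 0, ∃ N, ∀ n ≥ N, ∀ p : ContCStarSeminorm A, p.1 (val (u n) - a) ≤ ε := by
    intro ε hε
    obtain ⟨N, hN⟩ := hu ε hε
    refine ⟨N, fun n hn p => ?_⟩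
    have h1 : Tendsto (fun m => ε + p.1 (val (u m) - a)) atTop (𝓝 (ε + 0)) :=
      (ha' p).const_add ε
    rw [add_zero] at h1
    refine ge_of_tendsto h1 ?_
    filter_upwards [eventually_ge_atTop N] with m hm
    have h2 := map_add_le_add p.1.toSeminorm (val (u n) - val (u m)) (val (u m) - a)
    rw [sub_add_sub_cancel] at h2
    exact h2.trans (add_le_add ((hle p n m).trans (hN n hn m hm).le) le_rfl)
  have hab : BddAbove (Set.range fun p : ContCStarSeminorm A => p.1 a) := by
    obtain ⟨N, hN⟩ := key 1 one_pos
    refine ⟨1 + ‖u N‖, ?_⟩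
    rintro _ ⟨p, rfl⟩
    have h2 := map_sub_le_add p.1.toSeminorm (val (u N)) (val (u N) - a)
    rw [sub_sub_cancel] at h2
    have := hN N le_rfl p
    have := le_norm p (u N)
    change p.1 a ≤ _
    linarith
  let a' : BoundedAlgebra A := mk a hab
  refine ⟨a', Metric.tendsto_atTop.2 fun ε hε => ?_⟩
  obtain ⟨N, hN⟩ := key (ε / 2) (half_pos hε)
  refine ⟨N, fun n hn => ?_⟩
  rw [dist_eq_norm]
  refine lt_of_le_of_lt (norm_le fun p => ?_) (half_lt_self hε)
  rw [map_sub]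
  exact hN n hn p

/-- `b(A)` is a `C⋆`-algebra. -/
noncomputable instance : NonUnitalCStarAlgebra (BoundedAlgebra A) where

/-- The norm of `b(A)` as a continuous `C⋆`-seminorm. -/
noncomputable def normCStarSeminorm : ContCStarSeminorm (BoundedAlgebra A) :=
  ⟨{ normSeminorm ℂ (BoundedAlgebra A) with
      mul_le' := fun a b => norm_mul_le a b
      star_mul_self' := fun _ => CStarRing.norm_star_mul_self.trans (sq _).symm },
    continuous_norm⟩

/-- The `C⋆`-algebra `b(A)`, with its norm topology, is a pro-`C⋆`-algebra. -/
noncomputable instance : ProCStarAlgebra (BoundedAlgebra A) where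
  withSeminorms := by
    refine (norm_withSeminorms ℂ (BoundedAlgebra A)).congr (fun q => ?_) (fun _ => ?_)
    · obtain ⟨s, C, -, h⟩ := Seminorm.bound_of_continuous
        (norm_withSeminorms ℂ (BoundedAlgebra A)) q.1.toSeminorm q.2
      exact ⟨s, C, h⟩
    · refine ⟨{normCStarSeminorm}, 1, ?_⟩
      rw [Finset.sup_singleton, one_smul]
      exact le_of_eq rfl

end BoundedAlgebra
end boundedAlgebra

section boundedModule

variable (A : Type u) [ProCStarAlgebra A] (E : Type v) [AddCommGroup E] [Module ℂ E]

/-- The subspace of all `ξ` with `sup {p̄_E(ξ) | p ∈ S(A)} < ∞`. -/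
def boundedSubmodule [PreHilbertModule A E] : Submodule ℂ E where
  carrier := {ξ | BddAbove (Set.range fun p : ContCStarSeminorm A => p.1.bar ξ)}
  zero_mem' := ⟨0, by
    rintro _ ⟨p, rfl⟩
    change √(p.1 (inner A (0 : E) 0)) ≤ 0
    rw [(PreHilbertModule.inner_self_eq_zero (A := A) (0 : E)).2 rfl, map_zero, Real.sqrt_zero]⟩
  add_mem' := by
    rintro ξ η ⟨M, hM⟩ ⟨N, hN⟩
    refine ⟨M + N, ?_⟩
    rintro _ ⟨p, rfl⟩
    exact (PreHilbertModule.bar_add_le p.1 ξ η).trans (add_le_add (hM ⟨p, rfl⟩) (hN ⟨p, rfl⟩))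
  smul_mem' := by
    rintro c ξ ⟨M, hM⟩
    refine ⟨‖c‖ * M, ?_⟩
    rintro _ ⟨p, rfl⟩
    exact (PreHilbertModule.bar_smul p.1 c ξ).le.trans
      (mul_le_mul_of_nonneg_left (hM ⟨p, rfl⟩) (norm_nonneg c))

/-- `b(E)`: the space of bounded elements of `E`. -/
def BoundedModule [PreHilbertModule A E] : Type v := boundedSubmodule A E

namespace BoundedModule

variable {A E}
variable [PreHilbertModule A E]

noncomputable instance : AddCommGroup (BoundedModule A E) :=
  inferInstanceAs (AddCommGroup (boundedSubmodule A E))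
noncomputable instance : Module ℂ (BoundedModule A E) :=
  inferInstanceAs (Module ℂ (boundedSubmodule A E))

/-- The inclusion `b(E) ⊆ E`. -/
def val : BoundedModule A E →ₗ[ℂ] E := (boundedSubmodule A E).subtype

theorem val_injective : Function.Injective (val : BoundedModule A E → E) := Subtype.val_injective

/-- A bounded element of `E`, as an element of `b(E)`. -/
def mk (ξ : E) (h : BddAbove (Set.range fun p : ContCStarSeminorm A => p.1.bar ξ)) :
    BoundedModule A E := ⟨ξ, h⟩

@[simp] theorem val_mk (ξ : E)
    (h : BddAbove (Set.range fun p : ContCStarSeminorm A => p.1.bar ξ)) :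
    val (mk ξ h) = ξ := rfl

theorem bddAbove (ξ : BoundedModule A E) :
    BddAbove (Set.range fun p : ContCStarSeminorm A => p.1.bar (val ξ)) := ξ.2

theorem act_bounded (ξ : BoundedModule A E) (a : BoundedAlgebra A) :
    BddAbove (Set.range fun p : ContCStarSeminorm A => p.1.bar (val ξ <• a.val)) := by
  obtain ⟨M, hM⟩ := ξ.bddAbove
  obtain ⟨N, hN⟩ := a.bddAbove
  refine ⟨M * N, ?_⟩
  rintro _ ⟨p, rfl⟩
  exact (PreHilbertModule.bar_act_le p.1 _ _).trans (mul_le_mul (hM ⟨p, rfl⟩) (hN ⟨p, rfl⟩)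
    (p.1.nonneg _) ((PreHilbertModule.bar_nonneg p.1 _).trans (hM ⟨p, rfl⟩)))

theorem inner_bounded (ξ η : BoundedModule A E) :
    BddAbove (Set.range fun p : ContCStarSeminorm A => p.1 (inner A (val ξ) (val η))) := by
  obtain ⟨M, hM⟩ := ξ.bddAbove
  obtain ⟨N, hN⟩ := η.bddAbove
  refine ⟨M * N, ?_⟩
  rintro _ ⟨p, rfl⟩
  exact (PreHilbertModule.inner_le_bar p.1 _ _).trans (mul_le_mul (hM ⟨p, rfl⟩) (hN ⟨p, rfl⟩)
    (PreHilbertModule.bar_nonneg p.1 _)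
    ((PreHilbertModule.bar_nonneg p.1 _).trans (hM ⟨p, rfl⟩)))

theorem inner_self_pos (ξ : BoundedModule A E) :
    IsPositive (BoundedAlgebra.mk (inner A (val ξ) (val ξ)) (inner_bounded ξ ξ)) := by
  obtain ⟨b, hb⟩ := PreHilbertModule.inner_self_nonneg (A := A) (val ξ)
  have hbdd : BddAbove (Set.range fun p : ContCStarSeminorm A => p.1 b) := by
    obtain ⟨M, hM⟩ := ξ.bddAbove
    refine ⟨M, ?_⟩
    rintro _ ⟨p, rfl⟩
    refine le_trans (le_of_eq ?_) (hM ⟨p, rfl⟩)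
    change p.1 b = √(p.1 (inner A (val ξ) (val ξ)))
    rw [hb, p.1.star_mul_self, Real.sqrt_sq (p.1.nonneg b)]
  exact ⟨BoundedAlgebra.mk b hbdd, BoundedAlgebra.val_injective hb⟩

/-- `b(E)` is a pre-Hilbert `b(A)`-module, with the action and inner product of `E`. -/
noncomputable instance : PreHilbertModule (BoundedAlgebra A) (BoundedModule A E) where
  smul a ξ := mk (val ξ <• a.unop.val) (act_bounded ξ a.unop)
  inner ξ η := BoundedAlgebra.mk (inner A (val ξ) (val η)) (inner_bounded ξ η)
  act_add ξ a b := val_injective (PreHilbertModule.act_add (val ξ) a.val b.val)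
  add_act ξ η a := val_injective (PreHilbertModule.add_act (val ξ) (val η) a.val)
  act_mul ξ a b := val_injective (PreHilbertModule.act_mul (val ξ) a.val b.val)
  act_smul c ξ a := val_injective (PreHilbertModule.act_smul c (val ξ) a.val)
  smul_act c ξ a := val_injective (PreHilbertModule.smul_act c (val ξ) a.val)
  inner_add_right ξ η ζ := BoundedAlgebra.val_injective
    (PreHilbertModule.inner_add_right (val ξ) (val η) (val ζ))
  inner_smul_right c ξ η := BoundedAlgebra.val_injective
    (PreHilbertModule.inner_smul_right c (val ξ) (val η))
  inner_act_right ξ η a := BoundedAlgebra.val_injective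
    (PreHilbertModule.inner_act_right (val ξ) (val η) a.val)
  star_inner ξ η := BoundedAlgebra.val_injective
    (PreHilbertModule.star_inner (val ξ) (val η))
  inner_self_nonneg ξ := inner_self_pos ξ
  inner_self_eq_zero ξ := by
    rw [← val_injective.eq_iff, map_zero,
      ← PreHilbertModule.inner_self_eq_zero (A := A) (val ξ),
      ← BoundedAlgebra.val_injective.eq_iff, map_zero, BoundedAlgebra.val_mk]

theorem val_act (ξ : BoundedModule A E) (a : BoundedAlgebra A) :
    val (ξ <• a) = val ξ <• a.val := rfl

theorem val_inner (ξ η : BoundedModule A E) :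
    (inner (BoundedAlgebra A) ξ η).val = inner A (val ξ) (val η) := rfl

theorem bar_le (p : ContCStarSeminorm A) (ξ : BoundedModule A E) :
    p.1.bar (val ξ) ≤ (BoundedAlgebra.normCStarSeminorm (A := A)).1.bar ξ :=
  Real.sqrt_le_sqrt (BoundedAlgebra.le_norm p (inner (BoundedAlgebra A) ξ ξ))

theorem bar_norm_le {ξ : BoundedModule A E} {M : ℝ} (hM : 0 ≤ M)
    (h : ∀ p : ContCStarSeminorm A, p.1.bar (val ξ) ≤ M) :
    (BoundedAlgebra.normCStarSeminorm (A := A)).1.bar ξ ≤ M := by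
  refine Real.sqrt_le_iff.2 ⟨hM, BoundedAlgebra.norm_le fun p => ?_⟩
  rw [val_inner, ← PreHilbertModule.bar_sq]
  exact pow_le_pow_left₀ (PreHilbertModule.bar_nonneg p.1 _) (h p) 2

end BoundedModule

/-- `b(E)` is a Hilbert `b(A)`-module. -/
noncomputable instance BoundedModule.instHilbertModule {A : Type u} [ProCStarAlgebra A]
    {E : Type v} [AddCommGroup E] [Module ℂ E] [HilbertModule A E] :
    HilbertModule (BoundedAlgebra A) (BoundedModule A E) where
  complete F hF hc := by
    have hn := hc (BoundedAlgebra.normCStarSeminorm (A := A))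
    have hb0 (p : CStarSeminorm A) (ξ : E) := PreHilbertModule.bar_nonneg p ξ
    obtain ⟨ξ, hξ⟩ := HilbertModule.complete (A := A) (F.map val) inferInstance (fun p => by
      rw [Filter.prod_map_map_eq, Filter.tendsto_map'_iff]
      refine squeeze_zero (fun x => hb0 _ _) (fun x => ?_) hn
      have := bar_le p (x.1 - x.2)
      rw [map_sub] at this
      exact this)
    simp only [Filter.tendsto_map'_iff, Function.comp_def] at hξ
    have key : ∀ ε > 0, ∀ᶠ η in F, ∀ p : ContCStarSeminorm A, p.1.bar (val η - ξ) ≤ ε := by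
      intro ε hε
      have h1 : ∀ᶠ x in F ×ˢ F, (BoundedAlgebra.normCStarSeminorm (A := A)).1.bar (x.1 - x.2) < ε :=
        hn.eventually (Iio_mem_nhds hε)
      filter_upwards [h1.curry] with η hη p
      have h2 : Tendsto (fun ζ => ε + p.1.bar (val ζ - ξ)) F (𝓝 (ε + 0)) := (hξ p).const_add ε
      rw [add_zero] at h2
      refine ge_of_tendsto h2 ?_
      filter_upwards [hη] with ζ hζ
      have h3 := PreHilbertModule.bar_add_le p.1 (val η - val ζ) (val ζ - ξ)
      rw [sub_add_sub_cancel] at h3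
      have h4 := bar_le p (η - ζ)
      rw [map_sub] at h4
      exact h3.trans (add_le_add (h4.trans hζ.le) le_rfl)
    have hbdd : BddAbove (Set.range fun p : ContCStarSeminorm A => p.1.bar ξ) := by
      obtain ⟨η, hη⟩ := (key 1 one_pos).exists
      refine ⟨(BoundedAlgebra.normCStarSeminorm (A := A)).1.bar η + 1, ?_⟩
      rintro _ ⟨p, rfl⟩
      have h3 := PreHilbertModule.bar_add_le p.1 (val η) ((-1 : ℂ) • (val η - ξ))
      rw [PreHilbertModule.bar_smul, norm_neg, norm_one, one_mul, neg_one_smul,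
        ← sub_eq_add_neg, sub_sub_cancel] at h3
      exact h3.trans (add_le_add (bar_le p η) (hη p))
    let ξ' : BoundedModule A E := mk ξ hbdd
    have hlim : Tendsto (fun η : BoundedModule A E =>
        (BoundedAlgebra.normCStarSeminorm (A := A)).1.bar (η - ξ')) F (𝓝 0) := by
      rw [Metric.tendsto_nhds]
      intro ε hε
      filter_upwards [key (ε / 2) (half_pos hε)] with η hη
      rw [Real.dist_eq, sub_zero, abs_of_nonneg (PreHilbertModule.bar_nonneg _ _)]
      refine lt_of_le_of_lt (bar_norm_le (half_pos hε).le fun p => ?_) (half_lt_self hε)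
      rw [map_sub]
      exact hη p
    refine ⟨ξ', fun q => ?_⟩
    obtain ⟨C, hC, hq⟩ := Seminorm.bound_of_continuous_normedSpace q.1.toSeminorm q.2
    have h5 := hlim.const_mul (√C)
    rw [mul_zero] at h5
    refine squeeze_zero (fun x => PreHilbertModule.bar_nonneg _ _) (fun x => ?_) h5
    change √(q.1 (inner (BoundedAlgebra A) (x - ξ') (x - ξ'))) ≤
      √C * √‖inner (BoundedAlgebra A) (x - ξ') (x - ξ')‖
    rw [← Real.sqrt_mul hC.le]
    exact Real.sqrt_le_sqrt (hq _)

end boundedModule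

/-! ### Multipliers and frames -/

/-- A module morphism between Hilbert `A`-modules: a `ℂ`-linear and `A`-linear map. -/
structure ModuleMorphism (A : Type u) [ProCStarAlgebra A] (E : Type v) [AddCommGroup E]
    [Module ℂ E] [HilbertModule A E] (F : Type w) [AddCommGroup F] [Module ℂ F]
    [HilbertModule A F] extends E →ₗ[ℂ] F where
  map_act' : ∀ (ξ : E) (a : A), toFun (ξ <• a) = toFun ξ <• a

/-- `S` is an adjoint of `T`: `⟨T ξ, η⟩ = ⟨ξ, S η⟩` for all `ξ` and `η`. -/
def ModuleMorphism.IsAdjoint {A : Type u} [ProCStarAlgebra A] {E : Type v} [AddCommGroup E]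
    [Module ℂ E] [HilbertModule A E] {F : Type w} [AddCommGroup F] [Module ℂ F]
    [HilbertModule A F] (T : ModuleMorphism A E F) (S : ModuleMorphism A F E) : Prop :=
  ∀ (ξ : E) (η : F), inner A (T.toLinearMap ξ) η = inner A ξ (S.toLinearMap η)

/-- `L(E, F)`: the adjointable module morphisms from `E` to `F`. -/
structure Adjointable (A : Type u) [ProCStarAlgebra A] (E : Type v) [AddCommGroup E]
    [Module ℂ E] [HilbertModule A E] (F : Type w) [AddCommGroup F] [Module ℂ F]
    [HilbertModule A F] extends ModuleMorphism A E F where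
  exists_adjoint : ∃ S : ModuleMorphism A F E, toModuleMorphism.IsAdjoint S

namespace Adjointable

variable {A : Type u} [ProCStarAlgebra A] {E : Type v} [AddCommGroup E] [Module ℂ E]
  [HilbertModule A E] {F : Type w} [AddCommGroup F] [Module ℂ F] [HilbertModule A F]

instance : CoeFun (Adjointable A E F) (fun _ => E → F) := ⟨fun T => T.toLinearMap⟩

/-- The adjoint `T⋆` of an adjointable module morphism. -/
noncomputable def adjoint (T : Adjointable A E F) : Adjointable A F E where
  toModuleMorphism := T.exists_adjoint.choose
  exists_adjoint := ⟨T.toModuleMorphism, fun η ξ => by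
    rw [← PreHilbertModule.star_inner, ← T.exists_adjoint.choose_spec ξ η,
      PreHilbertModule.star_inner]⟩

theorem adjoint_spec (T : Adjointable A E F) (ξ : E) (η : F) :
    inner A (T ξ) η = inner A ξ (T.adjoint η) := T.exists_adjoint.choose_spec ξ η

end Adjointable

/-- The multiplier module `M(E) = L(A, E)`. Its elements are the multipliers of `E`. -/
abbrev Multiplier (A : Type u) [ProCStarAlgebra A] (E : Type v) [AddCommGroup E] [Module ℂ E]
    [HilbertModule A E] : Type (max u v) := Adjointable A A E

namespace Multiplier

variable {A : Type u} [ProCStarAlgebra A] {E : Type v} [AddCommGroup E] [Module ℂ E]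
  [HilbertModule A E]

/-- The inner product `⟨h, ξ⟩_{M(E)} = h⋆(ξ) ∈ A` of `h ∈ M(E)` and `ξ ∈ E ⊆ M(E)`. -/
noncomputable def innerLeft (h : Multiplier A E) (ξ : E) : A := h.adjoint ξ

/-- The inner product `⟨ξ, h⟩_{M(E)} = ⟨h, ξ⟩_{M(E)}⋆ ∈ A` of `ξ ∈ E ⊆ M(E)` and `h ∈ M(E)`. -/
noncomputable def innerRight (ξ : E) (h : Multiplier A E) : A := star (h.innerLeft ξ)

/-- `h` is a frame of multipliers with constants `C` and `D`: for every `ξ ∈ E`, the series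
`∑ₙ ⟨ξ, hₙ⟩ ⟨hₙ, ξ⟩` converges in `A`, and its sum `s` satisfies `C ⟨ξ, ξ⟩ ≤ s ≤ D ⟨ξ, ξ⟩`. -/
def IsFrameWith (h : ℕ → Multiplier A E) (C D : ℝ) : Prop :=
  ∀ ξ : E, ∃ s : A,
    Tendsto (fun N => ∑ n ∈ Finset.range N, innerRight ξ (h n) * innerLeft (h n) ξ) atTop (𝓝 s) ∧
    PosLE ((C : ℂ) • inner A ξ ξ) s ∧ PosLE s ((D : ℂ) • inner A ξ ξ)

/-- A standard frame of multipliers is normalised if the frame constants can be chosen as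
`C = D = 1`. -/
def IsStandardNormalisedFrame (h : ℕ → Multiplier A E) : Prop := IsFrameWith h 1 1

/-- The multiplier `H ∈ M(E)` extends the multiplier `h ∈ M(b(E))`: as maps, `H : A → E` agrees
with `h : b(A) → b(E)` on `b(A)`. -/
def Extends (H : Multiplier A E) (h : Multiplier (BoundedAlgebra A) (BoundedModule A E)) : Prop :=
  ∀ a : BoundedAlgebra A, H a.val = BoundedModule.val (h a)

end Multiplier

/-! Bounded elements generate: every `ξ : E` is `η (1 + x)` with `η` in `b(E)` and `x = ⟨ξ, ξ⟩`,
where `1` is a formal unit. Indeed `η = ξ (1 + x)⁻¹` has `⟨η, η⟩ = x (1 + x)⁻²`, which is bounded.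
As `A` need not be unital, `(1 + x)⁻¹` is written `1 - y` with `y = x (1 + x)⁻¹`, and `y` is
obtained as a limit of polynomials in `x` that converges for every continuous `C⋆`-seminorm
(`ProCStarAlgebra.exists_quasi_inverse`, `PreHilbertModule.exists_bounded_add_act`). The case `E =
A` gives `a = b (1 + x)` with `b` in `b(A)`.

A multiplier `h` of `b(E)` must therefore extend by `b (1 + x) ↦ h(b) (1 + x)`, with adjoint `η (1 +
x) ↦ h⋆(η) (1 + x)`. These formulas are adjoint to each other for any choice of decompositions, and
a pair of formally adjoint maps is automatically linear; so the choices are harmless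
(`Multiplier.exists_extends`).

At `ξ = η (1 + x)` both the frame sums and `⟨ξ, ξ⟩` are the conjugates `(1 + x)⋆ · (1 + x)` of their
values at `η`. Conjugation is continuous and preserves order, and so does the inclusion of `b(A)` in
`A`; hence the frame property passes from `b(E)` to `E`. -/

/-! ### Quasi-inverses of positive elements -/

/-- In a unital `C⋆`-algebra, `x (1 + x)⁻¹` for positive `x`, described without the unit. -/
theorem CStarAlgebra.exists_quasi_inverse {B : Type u} [CStarAlgebra B] [PartialOrder B]
    [StarOrderedRing B] {x : B} (hx : 0 ≤ x) :
    ∃ r : B, star r = r ∧ r + x * r = x ∧ x * r = r * x ∧ ‖r‖ ≤ 1 := by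
  have hsa : IsSelfAdjoint x := IsSelfAdjoint.of_nonneg hx
  have hpos : ∀ t ∈ spectrum ℝ x, 0 ≤ t := fun t ht => spectrum_nonneg_of_nonneg hx ht
  have hcont : ContinuousOn (fun t : ℝ => t / (1 + t)) (spectrum ℝ x) :=
    continuousOn_id.div (by fun_prop) fun t ht => by have := hpos t ht; positivity
  have hmul : x * cfc (fun t : ℝ => t / (1 + t)) x = cfc (fun t : ℝ => t * (t / (1 + t))) x := by
    rw [cfc_mul (fun t : ℝ => t) _ x, cfc_id' ℝ x]
  refine ⟨cfc (fun t : ℝ => t / (1 + t)) x, (cfc_predicate (fun t : ℝ => t / (1 + t)) x).star_eq,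
    ?_, ?_, ?_⟩
  · rw [hmul, ← cfc_add x _ (fun t : ℝ => t * (t / (1 + t))) hcont
      (continuousOn_id.mul hcont)]
    conv_rhs => rw [← cfc_id' ℝ x]
    refine cfc_congr fun t ht => ?_
    have := hpos t ht
    have h1 : 1 + t ≠ 0 := by positivity
    field_simp
  · rw [hmul, cfc_congr (g := fun t : ℝ => t / (1 + t) * t) fun t _ => mul_comm _ _,
      cfc_mul _ (fun t : ℝ => t) x, cfc_id' ℝ x]
  · refine norm_cfc_le zero_le_one fun t ht => ?_
    have := hpos t ht
    rw [Real.norm_of_nonneg (by positivity), div_le_one (by positivity)]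
    linarith

/-- The left side is the norm of `((1 - α) - α x) e`. Since `α x ≤ α ‖x‖ ≤ 1 - α`, the first factor
lies between `0` and `1 - α`. This is the contraction estimate for one step of `quasiInverseSeq`. -/
theorem CStarAlgebra.norm_sub_smul_add_mul_le {B : Type u} [CStarAlgebra B] [PartialOrder B]
    [StarOrderedRing B] {x : B} (hx : 0 ≤ x) {α : ℝ} (hα : 0 ≤ α) (h : α * (1 + ‖x‖) ≤ 1) (e : B) :
    ‖e - α • (e + x * e)‖ ≤ (1 - α) * ‖e‖ := by
  have hα1 : 0 ≤ 1 - α := by nlinarith [norm_nonneg x]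
  have hle : α • x ≤ algebraMap ℝ B (1 - α) := by
    have h1 : x ≤ algebraMap ℝ B ‖x‖ :=
      IsSelfAdjoint.le_algebraMap_norm_self (IsSelfAdjoint.of_nonneg hx)
    refine (smul_le_smul_of_nonneg_left h1 hα).trans ?_
    rw [Algebra.smul_def, ← map_mul]
    exact algebraMap_mono B (by linarith)
  have hnorm : ‖algebraMap ℝ B (1 - α) - α • x‖ ≤ 1 - α := by
    refine (CStarAlgebra.norm_le_norm_of_nonneg_of_le (sub_nonneg.2 hle)
      (sub_le_self _ (smul_nonneg hα hx))).trans ?_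
    -- In the zero algebra the unit has norm `0`, not `1`.
    rcases subsingleton_or_nontrivial B with _ | _
    · rw [Subsingleton.elim (algebraMap ℝ B (1 - α)) 0, norm_zero]
      exact hα1
    rw [norm_algebraMap', Real.norm_of_nonneg hα1]
  have heq : e - α • (e + x * e) = (algebraMap ℝ B (1 - α) - α • x) * e := by
    rw [sub_mul, ← Algebra.smul_def, smul_mul_assoc]
    module
  rw [heq]
  exact (norm_mul_le _ _).trans (mul_le_mul_of_nonneg_right hnorm (norm_nonneg e))

/-! ### Quasi-inverses in a pro-`C⋆`-algebra -/

namespace ProCStarAlgebra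

variable {A : Type u} [ProCStarAlgebra A]

/-- Polynomials in `x` which converge to `x (1 + x)⁻¹` locally uniformly on `[0, ∞)`. -/
noncomputable def quasiInverseSeq (x : A) : ℕ → A
  | 0 => 0
  -- An iteration for `(1 + x) y = x`. The step sizes tend to `0`, so they are eventually small
  -- enough for each seminorm `p`, however large `p x` is; their sum diverges, so the error still
  -- vanishes.
  | n + 1 => quasiInverseSeq x n +
      (((1 / (n + 1) : ℝ)) : ℂ) • (x - (quasiInverseSeq x n + x * quasiInverseSeq x n))

/-- The error satisfies `e (n + 1) = (1 - (1 + φ x) / (n + 1)) e n`. Once `n ≥ ‖φ x‖`, this factor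
has norm at most `n / (n + 1)`, so `n ‖e n‖` no longer increases and `e n = O(1 / n)`. -/
theorem tendsto_map_quasiInverseSeq {B : Type u} [CStarAlgebra B] [PartialOrder B]
    [StarOrderedRing B] (φ : A →⋆ₙₐ[ℂ] B) {x : A} (hx : 0 ≤ φ x) {r : B}
    (hr : r + φ x * r = φ x) :
    Tendsto (fun n => φ (quasiInverseSeq x n)) atTop (𝓝 r) := by
  set e : ℕ → B := fun n => φ (quasiInverseSeq x n) - r with he
  have hsucc (n : ℕ) : e (n + 1) = e n - (1 / (n + 1) : ℝ) • (e n + φ x * e n) := by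
    simp only [he, quasiInverseSeq, map_add, map_smul, map_sub, map_mul, mul_sub]
    rw [Complex.coe_smul, show φ x - (φ (quasiInverseSeq x n) + φ x * φ (quasiInverseSeq x n))
      = (r + φ x * r) - (φ (quasiInverseSeq x n) + φ x * φ (quasiInverseSeq x n)) by rw [hr]]
    module
  obtain ⟨N, hN⟩ := exists_nat_ge ‖φ x‖
  have hstep (n : ℕ) (hn : N ≤ n) : ((n + 1 : ℕ) : ℝ) * ‖e (n + 1)‖ ≤ n * ‖e n‖ := by
    have hn1 : (0 : ℝ) < n + 1 := by positivity
    have hxn : ‖φ x‖ ≤ n := hN.trans (by exact_mod_cast hn)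
    have h1 := CStarAlgebra.norm_sub_smul_add_mul_le hx (α := 1 / (n + 1)) (by positivity)
      (by rw [one_div_mul_eq_div, div_le_one hn1]; linarith) (e n)
    rw [← hsucc] at h1
    push_cast
    calc ((n : ℝ) + 1) * ‖e (n + 1)‖ ≤ (n + 1) * ((1 - 1 / (n + 1)) * ‖e n‖) :=
          mul_le_mul_of_nonneg_left h1 hn1.le
      _ = n * ‖e n‖ := by field_simp; ring
  have hbound (n : ℕ) (hn : N ≤ n) : (n : ℝ) * ‖e n‖ ≤ N * ‖e N‖ := by
    induction n, hn using Nat.le_induction with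
    | base => exact le_rfl
    | succ n hn ih => exact (hstep n hn).trans ih
  rw [tendsto_iff_norm_sub_tendsto_zero]
  refine squeeze_zero' (Eventually.of_forall fun n => norm_nonneg _) ?_
    (tendsto_const_div_atTop_nhds_zero_nat (N * ‖e N‖))
  filter_upwards [eventually_ge_atTop N, eventually_gt_atTop 0] with n hn hn0
  rw [le_div_iff₀ (by exact_mod_cast hn0), mul_comm]
  exact hbound n hn

/-- A positive element `x` has the bounded quasi-inverse `x (1 + x)⁻¹`. -/
theorem exists_quasi_inverse {x : A} (hx : IsPositive x) :
    ∃ y : A, star y = y ∧ y + x * y = x ∧ x * y = y * x ∧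
      ∀ p : ContCStarSeminorm A, p.1 y ≤ 1 := by
  have hrep (p : ContCStarSeminorm A) : ∃ (B : Type u) (_ : CStarAlgebra B) (φ : A →⋆ₙₐ[ℂ] B)
      (r : B), (∀ a, ‖φ a‖ = p.1 a) ∧ Tendsto (fun n => φ (quasiInverseSeq x n)) atTop (𝓝 r) ∧
      star r = r ∧ r + φ x * r = φ x ∧ φ x * r = r * φ x ∧ ‖r‖ ≤ 1 := by
    obtain ⟨B, _, φ, hφ⟩ := p.1.exists_cstar_rep
    let _ : PartialOrder B := CStarAlgebra.spectralOrder B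
    have : StarOrderedRing B := CStarAlgebra.spectralOrderedRing B
    have hpos : 0 ≤ φ x := by
      obtain ⟨b, rfl⟩ := hx
      rw [map_mul, map_star φ]
      exact star_mul_self_nonneg _
    obtain ⟨r, h1, h2, h3, h4⟩ := CStarAlgebra.exists_quasi_inverse hpos
    exact ⟨B, _, φ, r, hφ, tendsto_map_quasiInverseSeq φ hpos h2, h1, h2, h3, h4⟩
  have hcauchy : Cauchy (map (quasiInverseSeq x) atTop) := by
    refine cauchy_of_tendsto inferInstance fun p => ?_
    obtain ⟨B, _, φ, r, hφ, hlim, -⟩ := hrep p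
    rw [Filter.prod_map_map_eq, Filter.tendsto_map'_iff]
    have h1 := ((hlim.comp tendsto_fst).sub
      (hlim.comp (tendsto_snd (f := (atTop : Filter ℕ))))).norm
    rw [sub_self, norm_zero] at h1
    refine h1.congr fun n => ?_
    simp only [Function.comp, ← map_sub, hφ]
  obtain ⟨y, hy⟩ := CompleteSpace.complete hcauchy
  have hy' : Tendsto (quasiInverseSeq x) atTop (𝓝 y) := hy
  -- By uniqueness of limits `φ y = r`, so `φ y` inherits the properties of `r`. Identities then
  -- descend to `A`, because `‖φ a‖ = p a` and the seminorms separate points.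
  have hval (p : ContCStarSeminorm A) : ∃ (B : Type u) (_ : CStarAlgebra B) (φ : A →⋆ₙₐ[ℂ] B),
      (∀ a, ‖φ a‖ = p.1 a) ∧ star (φ y) = φ y ∧ φ y + φ x * φ y = φ x ∧
      φ x * φ y = φ y * φ x ∧ ‖φ y‖ ≤ 1 := by
    obtain ⟨B, _, φ, r, hφ, hlim, h⟩ := hrep p
    have h1 : Tendsto (fun n => φ (quasiInverseSeq x n)) atTop (𝓝 (φ y)) := by
      rw [tendsto_iff_norm_sub_tendsto_zero]
      simpa only [← map_sub, hφ] using tendsto_iff.1 hy' p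
    rw [← tendsto_nhds_unique h1 hlim] at h
    exact ⟨B, _, φ, hφ, h⟩
  refine ⟨y, ?_, ?_, ?_, fun p => ?_⟩
  · refine sub_eq_zero.1 (eq_zero_of_forall fun p => ?_)
    obtain ⟨B, _, φ, hφ, h, -⟩ := hval p
    rw [← hφ, map_sub, map_star φ, h, sub_self, norm_zero]
  · refine sub_eq_zero.1 (eq_zero_of_forall fun p => ?_)
    obtain ⟨B, _, φ, hφ, -, h, -⟩ := hval p
    rw [← hφ, map_sub, map_add, map_mul, h, sub_self, norm_zero]
  · refine sub_eq_zero.1 (eq_zero_of_forall fun p => ?_)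
    obtain ⟨B, _, φ, hφ, -, -, h, -⟩ := hval p
    rw [← hφ, map_sub, map_mul, map_mul, h, sub_self, norm_zero]
  · obtain ⟨B, _, φ, hφ, -, -, -, h⟩ := hval p
    rwa [← hφ]

/-- Continuity of multiplication is not an axiom of `ProCStarAlgebra`; it follows from
submultiplicativity of the seminorms. -/
theorem tendsto_const_mul {u : ℕ → A} {a : A} (b : A) (h : Tendsto u atTop (𝓝 a)) :
    Tendsto (fun n => b * u n) atTop (𝓝 (b * a)) := by
  refine tendsto_iff.2 fun p => ?_
  have h1 := (tendsto_iff.1 h p).const_mul (p.1 b)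
  rw [mul_zero] at h1
  refine squeeze_zero (fun n => p.1.nonneg _) (fun n => ?_) h1
  rw [← mul_sub]
  exact p.1.mul_le _ _

theorem tendsto_mul_const {u : ℕ → A} {a : A} (b : A) (h : Tendsto u atTop (𝓝 a)) :
    Tendsto (fun n => u n * b) atTop (𝓝 (a * b)) := by
  refine tendsto_iff.2 fun p => ?_
  have h1 := (tendsto_iff.1 h p).mul_const (p.1 b)
  rw [zero_mul] at h1
  refine squeeze_zero (fun n => p.1.nonneg _) (fun n => ?_) h1
  rw [← sub_mul]
  exact p.1.mul_le _ _

end ProCStarAlgebra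

/-! ### Conjugation by `1 + x` -/

/-- The conjugate `(1 + x)⋆ a (1 + x)`, as an element of the possibly non-unital algebra. -/
def conjOneAdd {A : Type u} [ProCStarAlgebra A] (x a : A) : A :=
  a + a * x + star x * (a + a * x)

section conjOneAdd

variable {A : Type u} [ProCStarAlgebra A]

theorem conjOneAdd_add (x a b : A) : conjOneAdd x (a + b) = conjOneAdd x a + conjOneAdd x b := by
  simp only [conjOneAdd, add_mul, mul_add]; abel

theorem conjOneAdd_zero (x : A) : conjOneAdd x 0 = 0 := by simp [conjOneAdd]

theorem conjOneAdd_sub (x a b : A) : conjOneAdd x (a - b) = conjOneAdd x a - conjOneAdd x b := by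
  simp only [conjOneAdd, sub_mul, mul_sub, mul_add]; abel

theorem conjOneAdd_sum (x : A) {ι : Type w} (s : Finset ι) (f : ι → A) :
    conjOneAdd x (∑ i ∈ s, f i) = ∑ i ∈ s, conjOneAdd x (f i) :=
  map_sum (⟨⟨conjOneAdd x, conjOneAdd_zero x⟩, conjOneAdd_add x⟩ : A →+ A) f s

/-- Used twice: it makes conjugation preserve positivity, and it turns the frame terms at `η` into
those at `η (1 + x)`. -/
theorem star_mul_self_add_mul (x a : A) :
    star (a + a * x) * (a + a * x) = conjOneAdd x (star a * a) := by
  simp only [conjOneAdd, star_add, star_mul, add_mul, mul_add, mul_assoc]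
  abel

theorem PosLE.conjOneAdd {a b : A} (h : PosLE a b) (x : A) :
    PosLE (conjOneAdd x a) (conjOneAdd x b) := by
  obtain ⟨c, hc⟩ := h
  exact ⟨c + c * x, by rw [← conjOneAdd_sub, hc, star_mul_self_add_mul]⟩

theorem tendsto_conjOneAdd {u : ℕ → A} {a : A} (x : A) (h : Tendsto u atTop (𝓝 a)) :
    Tendsto (fun n => conjOneAdd x (u n)) atTop (𝓝 (conjOneAdd x a)) := by
  have h1 := h.add (ProCStarAlgebra.tendsto_mul_const x h)
  exact h1.add (ProCStarAlgebra.tendsto_const_mul (star x) h1)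

end conjOneAdd

/-! ### Limits and order under the inclusion of `b(A)` in `A` -/

namespace BoundedAlgebra

variable {A : Type u} [ProCStarAlgebra A]

theorem tendsto_val {u : ℕ → BoundedAlgebra A} {a : BoundedAlgebra A}
    (h : Tendsto u atTop (𝓝 a)) : Tendsto (fun n => (u n).val) atTop (𝓝 a.val) := by
  refine ProCStarAlgebra.tendsto_iff.2 fun p => ?_
  refine squeeze_zero (fun n => p.1.nonneg _) (fun n => ?_)
    (ProCStarAlgebra.tendsto_iff.1 h normCStarSeminorm)
  rw [← map_sub]
  exact le_norm p _

theorem _root_.PosLE.val {a b : BoundedAlgebra A} (h : PosLE a b) : PosLE a.val b.val := by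
  obtain ⟨c, hc⟩ := h
  exact ⟨c.val, by rw [← map_sub, hc, map_mul, map_star BoundedAlgebra.val]⟩

end BoundedAlgebra

/-! ### Bounded elements generate -/

namespace PreHilbertModule

variable {A : Type u} [ProCStarAlgebra A] {E : Type v} [AddCommGroup E] [Module ℂ E]
  [PreHilbertModule A E]

theorem inner_neg_right (ξ η : E) : inner A ξ (-η) = -inner A ξ η := by
  rw [← neg_one_smul ℂ η, inner_smul_right, neg_one_smul]

theorem inner_sub_right (ξ η ζ : E) : inner A ξ (η - ζ) = inner A ξ η - inner A ξ ζ := by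
  rw [sub_eq_add_neg, inner_add_right, inner_neg_right, ← sub_eq_add_neg]

theorem ext_inner_left {η ζ : E} (h : ∀ ξ : E, inner A ξ η = inner A ξ ζ) : η = ζ := by
  rw [← sub_eq_zero, ← inner_self_eq_zero (A := A), inner_sub_right, h, sub_self]

theorem ext_inner_right {η ζ : E} (h : ∀ ξ : E, inner A η ξ = inner A ζ ξ) : η = ζ :=
  ext_inner_left (A := A) fun ξ => by rw [← star_inner, h, star_inner]

theorem inner_add_act_self (ξ : E) (x : A) :
    inner A (ξ + ξ <• x) (ξ + ξ <• x) = conjOneAdd x (inner A ξ ξ) := by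
  simp only [conjOneAdd, inner_add_right, inner_add_left, inner_act_right, inner_act_left,
    mul_add, add_mul, mul_assoc]
  abel

/-- Every element has the form `η (1 + x)` with `η` bounded. -/
theorem exists_bounded_add_act (ξ : E) :
    ∃ (η : BoundedModule A E) (x : A), ξ = BoundedModule.val η + BoundedModule.val η <• x := by
  obtain ⟨y, hsa, hy, hcomm, hle⟩ :=
    ProCStarAlgebra.exists_quasi_inverse (inner_self_nonneg (A := A) ξ)
  set x : A := inner A ξ ξ with hx
  -- This is `ξ (1 - y) = ξ (1 + x)⁻¹`.
  set η : E := ξ + ξ <• (-y) with hη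
  -- `(1 - y) x (1 - y) = y (1 - y)`, because `x - x y = y`.
  have hin : inner A η η = y - y * y := by
    have h1 : x - x * y = y := by rw [sub_eq_iff_eq_add]; exact hy.symm
    rw [hη, inner_add_act_self, conjOneAdd, ← hx, star_neg, hsa, mul_neg, ← sub_eq_add_neg, h1,
      neg_mul, ← sub_eq_add_neg]
  have hbdd : BddAbove (Set.range fun p : ContCStarSeminorm A => p.1.bar η) := by
    -- A crude bound: `p (y - y²) ≤ p y + (p y)² ≤ 2`.
    refine ⟨√2, ?_⟩
    rintro _ ⟨p, rfl⟩
    refine Real.sqrt_le_sqrt ?_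
    rw [hin]
    have h1 := map_sub_le_add p.1.toSeminorm y (y * y)
    have h2 := p.1.mul_le y y
    have h3 := hle p
    have h4 := p.1.nonneg y
    nlinarith
  refine ⟨BoundedModule.mk η hbdd, x, ?_⟩
  rw [BoundedModule.val_mk]
  -- `(1 - y) (1 + x) = 1` with the unit cancelled; commutation of `x` and `y` enters here.
  have h0 : -y + (x + -y * x) = 0 := by
    have h1 : x - y - x * y = 0 := by rw [sub_sub, hy, sub_self]
    rw [neg_mul, ← hcomm, ← h1]
    abel
  rw [hη, add_act, ← act_mul, add_assoc, ← act_add, ← act_add, h0]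
  -- What remains is that `0` acts as zero, seen by pairing with every `ζ`.
  refine ext_inner_left (A := A) fun ζ => ?_
  rw [inner_add_right, inner_act_right, mul_zero, add_zero]

end PreHilbertModule

/-- The module case with `E = A`: there `p̄(b) = √(p (b⋆ b)) = p b`, so the two notions of
boundedness agree. -/
theorem ProCStarAlgebra.exists_bounded_add_mul {A : Type u} [ProCStarAlgebra A] (a : A) :
    ∃ (b : BoundedAlgebra A) (x : A), a = b.val + b.val * x := by
  obtain ⟨b, x, h⟩ := PreHilbertModule.exists_bounded_add_act (A := A) a
  obtain ⟨M, hM⟩ := b.bddAbove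
  refine ⟨BoundedAlgebra.mk (BoundedModule.val b) ⟨M, ?_⟩, x, h⟩
  rintro _ ⟨p, rfl⟩
  refine le_trans (le_of_eq ?_) (hM ⟨p, rfl⟩)
  change _ = √(p.1 (star (BoundedModule.val b) * BoundedModule.val b))
  rw [p.1.star_mul_self, Real.sqrt_sq (p.1.nonneg _)]

/-! ### Adjointable maps -/

section adjointable

variable {A : Type u} [ProCStarAlgebra A] {E : Type v} [AddCommGroup E] [Module ℂ E]
  [HilbertModule A E] {F : Type w} [AddCommGroup F] [Module ℂ F] [HilbertModule A F]

/-- A map with a formal adjoint is a module morphism. -/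
def ModuleMorphism.ofAdjoint (T : E → F) (S : F → E)
    (h : ∀ ξ η, inner A (T ξ) η = inner A ξ (S η)) : ModuleMorphism A E F where
  toFun := T
  map_add' ξ ζ := PreHilbertModule.ext_inner_right (A := A) fun η => by
    simp only [h, PreHilbertModule.inner_add_left]
  map_smul' c ξ := PreHilbertModule.ext_inner_right (A := A) fun η => by
    simp only [h, PreHilbertModule.inner_smul_left, RingHom.id_apply]
  map_act' ξ a := PreHilbertModule.ext_inner_right (A := A) fun η => by
    simp only [h, PreHilbertModule.inner_act_left]

/-- A map with a formal adjoint is adjointable. -/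
def Adjointable.ofAdjoint (T : E → F) (S : F → E)
    (h : ∀ ξ η, inner A (T ξ) η = inner A ξ (S η)) : Adjointable A E F where
  toModuleMorphism := ModuleMorphism.ofAdjoint T S h
  exists_adjoint := ⟨ModuleMorphism.ofAdjoint S T fun η ξ => by
    rw [← PreHilbertModule.star_inner, ← h, PreHilbertModule.star_inner], h⟩

theorem Adjointable.ofAdjoint_apply (T : E → F) (S : F → E)
    (h : ∀ ξ η, inner A (T ξ) η = inner A ξ (S η)) (ξ : E) : ofAdjoint T S h ξ = T ξ := rfl

/-- `adjoint` is picked by choice, but adjoints are unique since the inner product is definite. -/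
theorem Adjointable.adjoint_ofAdjoint_apply (T : E → F) (S : F → E)
    (h : ∀ ξ η, inner A (T ξ) η = inner A ξ (S η)) (η : F) :
    (ofAdjoint T S h).adjoint η = S η :=
  PreHilbertModule.ext_inner_left (A := A) fun ξ => by rw [← adjoint_spec, ← h, ofAdjoint_apply]

theorem Adjointable.ext {T S : Adjointable A E F} (h : ∀ ξ, T ξ = S ξ) : T = S := by
  obtain ⟨⟨T, _⟩, _⟩ := T
  obtain ⟨⟨S, _⟩, _⟩ := S
  obtain rfl : T = S := LinearMap.ext h
  rfl

theorem Adjointable.map_add_act (T : Adjointable A E F) (ξ : E) (a : A) :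
    T (ξ + ξ <• a) = T ξ + T ξ <• a := by
  rw [map_add]
  exact congrArg _ (T.map_act' ξ a)

end adjointable

/-! ### Extension of multipliers -/

namespace Multiplier

variable {A : Type u} [ProCStarAlgebra A] {E : Type v} [AddCommGroup E] [Module ℂ E]
  [HilbertModule A E]

/-- Adjointness over `b(A)`, read in `A`, where it can be multiplied by unbounded elements. -/
theorem inner_val_eq (h : Multiplier (BoundedAlgebra A) (BoundedModule A E)) (b : BoundedAlgebra A)
    (η : BoundedModule A E) :
    inner A (BoundedModule.val (h b)) (BoundedModule.val η) =
      star b.val * (h.adjoint η).val := by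
  have h1 := congrArg BoundedAlgebra.val (h.adjoint_spec b η)
  rw [BoundedModule.val_inner] at h1
  rw [h1]
  change BoundedAlgebra.val (star b * h.adjoint η) = _
  rw [map_mul, map_star BoundedAlgebra.val]

/-- A multiplier of `b(E)` extends to a multiplier of `E`; on `η (1 + x)` with `η` bounded, the
adjoint of the extension is `h⋆(η) (1 + x)`. -/
theorem exists_extends (h : Multiplier (BoundedAlgebra A) (BoundedModule A E)) :
    ∃ H : Multiplier A E, H.Extends h ∧ ∀ (η : BoundedModule A E) (x : A),
      H.adjoint (BoundedModule.val η + BoundedModule.val η <• x) =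
        (h.adjoint η).val + (h.adjoint η).val * x := by
  -- The decompositions are arbitrary; no compatibility between them is needed.
  choose b x hbx using ProCStarAlgebra.exists_bounded_add_mul (A := A)
  choose η y hηy using PreHilbertModule.exists_bounded_add_act (A := A) (E := E)
  -- Both sides equal `(1 + x a)⋆ (b a)⋆ h⋆(η ξ) (1 + y ξ)`.
  have key (a : A) (ξ : E) :
      inner A (BoundedModule.val (h (b a)) + BoundedModule.val (h (b a)) <• x a) ξ =
      inner A a ((h.adjoint (η ξ)).val + (h.adjoint (η ξ)).val * y ξ) := by
    change _ = star a * _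
    conv_lhs => rw [hηy ξ]
    conv_rhs => rw [hbx a]
    simp only [PreHilbertModule.inner_add_right, PreHilbertModule.inner_add_left,
      PreHilbertModule.inner_act_right, PreHilbertModule.inner_act_left, inner_val_eq, star_add, star_mul, mul_add, add_mul, mul_assoc]
  -- The decomposition chosen for `a.val` may be nontrivial, so the value is tested against `ξ`: by
  -- `key`, only the decomposition of `ξ` then matters.
  have hext : Multiplier.Extends (Adjointable.ofAdjoint _ _ key) h := fun a => by
    refine PreHilbertModule.ext_inner_right (A := A) fun ξ => ?_
    rw [Adjointable.ofAdjoint_apply, key]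
    change star a.val * _ = _
    conv_rhs => rw [hηy ξ]
    rw [PreHilbertModule.inner_add_right, PreHilbertModule.inner_act_right, inner_val_eq,
      mul_add, mul_assoc]
  refine ⟨Adjointable.ofAdjoint _ _ key, hext, fun ζ z => ?_⟩
  rw [Adjointable.map_add_act]
  -- By `A`-linearity of the adjoint it suffices to treat bounded `ζ`.
  suffices hz : (Adjointable.ofAdjoint _ _ key : Multiplier A E).adjoint (BoundedModule.val ζ) =
      (h.adjoint ζ).val by
    rw [hz]
    rfl
  refine PreHilbertModule.ext_inner_left (A := A) fun a => ?_
  rw [← Adjointable.adjoint_spec]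
  conv_rhs => rw [hbx a]
  conv_lhs => rw [hbx a]
  have h1 := Adjointable.map_add_act (Adjointable.ofAdjoint _ _ key : Multiplier A E)
    (b a).val (x a)
  change inner A ((Adjointable.ofAdjoint _ _ key : Multiplier A E)
    ((b a).val + (b a).val <• x a)) _ = star ((b a).val + (b a).val * x a) * _
  rw [h1, hext, PreHilbertModule.inner_add_left, PreHilbertModule.inner_act_left, inner_val_eq,
    star_add, star_mul, add_mul, mul_assoc]

/-- Every element of `A` is `b (1 + x)` with `b` bounded, so an `A`-linear map is determined by its
restriction to `b(A)`. -/
theorem Extends.unique {h : Multiplier (BoundedAlgebra A) (BoundedModule A E)}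
    {S T : Multiplier A E} (hS : S.Extends h) (hT : T.Extends h) : S = T := by
  refine Adjointable.ext fun a => ?_
  obtain ⟨b, x, rfl⟩ := ProCStarAlgebra.exists_bounded_add_mul a
  have h1 := S.map_add_act b.val x
  have h2 := T.map_add_act b.val x
  rw [hS] at h1
  rw [hT] at h2
  exact h1.trans h2.symm

end Multiplier

/-- If `h` is a standard normalised frame of multipliers in the Hilbert `b(A)`-module `b(E)`, then
every `h n` has exactly one extension `H n` to a multiplier of `E`, and the sequence `H` is a
standard normalised frame of multipliers in `E`. -/
theorem corollary3p9 {A : Type u} [ProCStarAlgebra A] {E : Type v} [AddCommGroup E] [Module ℂ E]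
    [HilbertModule A E] (h : ℕ → Multiplier (BoundedAlgebra A) (BoundedModule A E))
    (hh : Multiplier.IsStandardNormalisedFrame h) :
    ∃ H : ℕ → Multiplier A E,
      (∀ n, (H n).Extends (h n) ∧ ∀ T : Multiplier A E, T.Extends (h n) → T = H n) ∧
        Multiplier.IsStandardNormalisedFrame H := by
  choose H hext hadj using fun n => Multiplier.exists_extends (h n)
  refine ⟨H, fun n => ⟨hext n, fun T hT => hT.unique (hext n)⟩, fun ξ => ?_⟩
  obtain ⟨η, x, rfl⟩ := PreHilbertModule.exists_bounded_add_act (A := A) ξ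
  obtain ⟨s, hs, hs1, hs2⟩ := hh η
  simp only [Complex.ofReal_one, one_smul] at hs1 hs2 ⊢
  -- The sum at `η (1 + x)` is the conjugate of the sum `s` at `η`.
  refine ⟨conjOneAdd x s.val, ?_, ?_, ?_⟩
  · refine (tendsto_conjOneAdd x (BoundedAlgebra.tendsto_val hs)).congr fun N => ?_
    rw [map_sum, conjOneAdd_sum]
    refine Finset.sum_congr rfl fun n _ => ?_
    -- With `c = (h n)⋆(η)`, `hadj` gives `(H n)⋆(η (1 + x)) = c (1 + x)`, so the `n`-th term is the
    -- conjugate of `c⋆ c`.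
    simp only [Multiplier.innerRight, Multiplier.innerLeft, map_mul, map_star BoundedAlgebra.val,
      hadj, star_mul_self_add_mul]
  · rw [PreHilbertModule.inner_add_act_self]
    exact hs1.val.conjOneAdd x
  · rw [PreHilbertModule.inner_add_act_self]
    exact hs2.val.conjOneAdd x
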